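/- All matroids are finite. For a matroid $M$ with ground set $E(M)$ and rank function $r_M$, let $\lambda_M(X) = r_M(X) + r_M(E(M)\setminus X) - r_M(E(M))$ for $X\subseteq E(M)$. A partition $(X,Y)$ of $E(M)$ is a $k$-separation of $M$ if $|X|,|Y|\ge k$ and $\lambda_M(X)<k$, and $M$ is $3$-connected if it has no $k'$-separation with $k'<3$. A tangle of $M$ of order $\theta$ is a collection $\mathcal T$ of subsets of $E(M)$ such that: (i) $\lambda_M(X)<\theta$ for all $X\in\mathcal T$; (ii) for each $X\subseteq E(M)$ with $\lambda_M(X)<\theta$, $X\in\mathcal T$ or $E(M)\setminus X\in\mathcal T$; (iii) $X\cup Y\cup Z\ne E(M)$ for all $X,Y,Z\in\mathcal T$; (iv) $E(M)\setminus\{e\}\notin\mathcal T$ for each $e\in E(M)$. The tangle matroid $M(\mathcal T)$ is the matroid on $E(M)$ whose rank function $r_{\mathcal T}$ is given by $r_{\mathcal T}(X)=\min\{\lambda_M(Y) : X\subseteq Y\in\mathcal T\}$ if some member of $\mathcal T$ contains $X$, and $r_{\mathcal T}(X)=\theta$ otherwise. A long line of a matroid is a closed set of rank two with at least three elements. A triangle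 of $M$ is a $3$-element circuit, and a triad of $M$ is a $3$-element circuit of the dual $M^*$. A fan of $M$ of length $k\ge 3$ is a sequence $(x_1,\dots,x_k)$ of distinct elements of $E(M)$ such that $\{x_1,x_2,x_3\}$ is a triangle or a triad and, for each $i\in\{1,\dots,k-3\}$, if $\{x_i,x_{i+1},x_{i+2}\}$ is a triangle then $\{x_{i+1},x_{i+2},x_{i+3}\}$ is a triad, and if $\{x_i,x_{i+1},x_{i+2}\}$ is a triad then $\{x_{i+1},x_{i+2},x_{i+3}\}$ is a triangle. A fan of $M$ is maximal if its set of elements is not properly contained in the set of elements of another fan of $M$. Let $M$ be a $3$-connected matroid, let $\mathcal T$ be a tangle of $M$, let $N$ be a minor of $M$, and let $X_1,\dots,X_r$ be long lines of $M(\mathcal T)$ with $r_{\mathcal T}(X_1\cup\dots\cup X_r)=2r$. Suppose that the following hold for all $i\in\{1,\dots,r\}$: 1. $X_i\cap E(N)=\emptyset$; 2. $X_i$ contains (all elements of) a maximal fan $F_i$ of $M$ of length at least four; 3. $e_i$ is an element of $F_i$ such that $M\backslash e_i$ is $3$-connected with $N$ as a minor. Then $M\backslash\{e_1,\dots,e_r\}$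 is $3$-connected with $N$ as a minor. -/

import Mathlib

open scoped Matroid

namespace Matroid

variable {α : Type*}

noncomputable section

/-- The rank `r_M(X)` as a natural number. It is only used for finite matroids, where the
`ℕ∞`-valued rank is finite. -/
def natRk (M : Matroid α) (X : Set α) : ℕ := (M.eRk X).toNat

/-- The connectivity function `λ_M(X) = r_M(X) + r_M(E(M) \ X) - r(M)`. The subtraction
does not truncate, see `natRk_ground_le`. -/
def conn (M : Matroid α) (X : Set α) : ℕ := M.natRk X + M.natRk (M.E \ X) - M.natRk M.E

/-- `(X, Y)` is a `k`-separation of `M`. -/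
structure IsKSeparation (M : Matroid α) (k : ℕ) (X Y : Set α) : Prop where
  union_eq : X ∪ Y = M.E
  disjoint : Disjoint X Y
  le_left : (k : ℕ∞) ≤ X.encard
  le_right : (k : ℕ∞) ≤ Y.encard
  conn_lt : M.conn X < k

/-- `M` is `k`-connected if it has no `k'`-separation with `k' < k`. -/
def IsKConnected (M : Matroid α) (k : ℕ) : Prop :=
  ∀ k' < k, ∀ X Y : Set α, ¬ M.IsKSeparation k' X Y

/-- A triangle of `M`: a set `T` with `M|T ≅ U_{2,3}`, that is, a 3-element circuit. -/
def IsTriangle (M : Matroid α) (T : Set α) : Prop := M.IsCircuit T ∧ T.encard = 3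

/-- A triad of `M` is a triangle of the dual of `M`. -/
def IsTriad (M : Matroid α) (T : Set α) : Prop := M✶.IsTriangle T

/-- The ordered set `F = (x_1, ..., x_k)` is a fan of `M` (indices are shifted to start at 0). -/
structure IsFan (M : Matroid α) (F : List α) : Prop where
  three_le : 3 ≤ F.length
  nodup : F.Nodup
  subset_ground : ∀ x ∈ F, x ∈ M.E
  start : M.IsTriangle {F[0], F[1], F[2]} ∨ M.IsTriad {F[0], F[1], F[2]}
  triad_of_triangle : ∀ (i : ℕ) (_ : i + 3 < F.length),
    M.IsTriangle {F[i], F[i + 1], F[i + 2]} → M.IsTriad {F[i + 1], F[i + 2], F[i + 3]}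
  triangle_of_triad : ∀ (i : ℕ) (_ : i + 3 < F.length),
    M.IsTriad {F[i], F[i + 1], F[i + 2]} → M.IsTriangle {F[i + 1], F[i + 2], F[i + 3]}

/-- `F` is an inclusionwise maximal fan of `M`: its set of elements is not properly contained
in the set of elements of another fan of `M`. -/
def IsMaximalFan (M : Matroid α) (F : List α) : Prop :=
  M.IsFan F ∧ ∀ F' : List α, M.IsFan F' → F ⊆ F' → F' ⊆ F

/-- A line of `M` is a closed set of rank two; it is long if it has at least three elements. -/
structure IsLongLine (M : Matroid α) (X : Set α) : Prop where
  isFlat : M.IsFlat X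
  rank_eq : M.eRk X = 2
  three_le : 3 ≤ X.encard

/-- `T` is a tangle of order `θ` of `M`. -/
structure IsTangle (M : Matroid α) (T : Set (Set α)) (θ : ℕ) : Prop where
  subset_ground : ∀ X ∈ T, X ⊆ M.E
  conn_lt : ∀ X ∈ T, M.conn X < θ
  mem_or_compl_mem : ∀ X ⊆ M.E, M.conn X < θ → X ∈ T ∨ M.E \ X ∈ T
  union_ne : ∀ X ∈ T, ∀ Y ∈ T, ∀ Z ∈ T, X ∪ Y ∪ Z ≠ M.E
  compl_singleton_notMem : ∀ e ∈ M.E, M.E \ {e} ∉ T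

open Classical in
/-- The rank function of the tangle matroid: the minimum of `λ_M(Y)` over all `Y ∈ T` that
contain `X` if there is such a `Y`, and `θ` otherwise. -/
def tangleRk (M : Matroid α) (T : Set (Set α)) (θ : ℕ) (X : Set α) : ℕ :=
  if ∃ Y ∈ T, X ⊆ Y then sInf {n | ∃ Y ∈ T, X ⊆ Y ∧ M.conn Y = n} else θ

section RankFunction

variable {E : Set α} {f : Set α → ℕ}

lemma rankFun_union_le (hE : E.Finite)
    (h_insert : ∀ X ⊆ E, ∀ e ∈ E, f (insert e X) ≤ f X + 1)
    {X Y : Set α} (hX : X ⊆ E) (hY : Y ⊆ E) : f (X ∪ Y) ≤ f X + Y.ncard := by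
  induction Y, hE.subset hY using Set.Finite.induction_on with
  | empty => simp
  | @insert a Y ha hYf ih =>
    obtain ⟨haE, hYE⟩ := Set.insert_subset_iff.1 hY
    rw [Set.union_insert, Set.ncard_insert_of_notMem ha hYf]
    have := h_insert (X ∪ Y) (Set.union_subset hX hYE) a haE
    have := ih hYE
    omega

lemma rankFun_union_eq (hE : E.Finite)
    (h_mono : ∀ X Y, X ⊆ Y → Y ⊆ E → f X ≤ f Y)
    (h_submod : ∀ X ⊆ E, ∀ Y ⊆ E, f (X ∩ Y) + f (X ∪ Y) ≤ f X + f Y)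
    {X Y : Set α} (hX : X ⊆ E) (hY : Y ⊆ E) (h : ∀ e ∈ Y, f (insert e X) = f X) :
    f (X ∪ Y) = f X := by
  induction Y, hE.subset hY using Set.Finite.induction_on with
  | empty => simp
  | @insert a Y ha hYf ih =>
    obtain ⟨haE, hYE⟩ := Set.insert_subset_iff.1 hY
    have h1 := ih hYE fun e he => h e (Set.mem_insert_of_mem _ he)
    have h2 := h a (Set.mem_insert _ _)
    have h3 := h_submod (X ∪ Y) (Set.union_subset hX hYE) (insert a X)
      (Set.insert_subset haE hX)
    have h4 : f X ≤ f ((X ∪ Y) ∩ insert a X) :=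
      h_mono _ _ (Set.subset_inter Set.subset_union_left (Set.subset_insert _ _))
        (Set.inter_subset_left.trans (Set.union_subset hX hYE))
    have h5 : (X ∪ Y) ∪ insert a X = X ∪ insert a Y := by
      ext x; simp only [Set.mem_union, Set.mem_insert_iff]; tauto
    have h6 : f X ≤ f (X ∪ insert a Y) :=
      h_mono _ _ Set.subset_union_left (Set.union_subset hX hY)
    rw [h5] at h3
    omega

/-- The matroid on a finite set `E` with a given rank function. -/
def ofRankFun (hE : E.Finite) (f : Set α → ℕ) (h_empty : f ∅ = 0)
    (h_mono : ∀ X Y, X ⊆ Y → Y ⊆ E → f X ≤ f Y)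
    (h_insert : ∀ X ⊆ E, ∀ e ∈ E, f (insert e X) ≤ f X + 1)
    (h_submod : ∀ X ⊆ E, ∀ Y ⊆ E, f (X ∩ Y) + f (X ∪ Y) ≤ f X + f Y) : Matroid α :=
  (IndepMatroid.ofFinite hE (fun I => I ⊆ E ∧ f I = I.ncard)
    ⟨Set.empty_subset _, by simpa using h_empty⟩
    (by
      rintro I J ⟨hJE, hJ⟩ hIJ
      refine ⟨hIJ.trans hJE, ?_⟩
      have h1 := rankFun_union_le hE h_insert (hIJ.trans hJE)
        ((Set.sdiff_subset (t := I)).trans hJE)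
      have h2 := rankFun_union_le hE h_insert (Set.empty_subset E) (hIJ.trans hJE)
      rw [Set.union_sdiff_cancel hIJ] at h1
      rw [Set.empty_union, h_empty] at h2
      have h3 := Set.ncard_sdiff_add_ncard_of_subset hIJ (hE.subset hJE)
      omega)
    (by
      rintro I J ⟨hIE, hI⟩ ⟨hJE, hJ⟩ hlt
      by_contra! hcon
      have h1 : f (I ∪ J) = f I := by
        refine rankFun_union_eq hE h_mono h_submod hIE hJE fun e he => ?_
        by_cases heI : e ∈ I
        · rw [Set.insert_eq_of_mem heI]
        have h2 := hcon e he heI (Set.insert_subset (hJE he) hIE)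
        rw [Set.ncard_insert_of_notMem heI (hE.subset hIE)] at h2
        have h3 := h_insert I hIE e (hJE he)
        have h4 := h_mono I (insert e I) (Set.subset_insert _ _)
          (Set.insert_subset (hJE he) hIE)
        omega
      have h2 := h_mono J (I ∪ J) Set.subset_union_right (Set.union_subset hIE hJE)
      omega)
    (fun _ h => h.1)).matroid

lemma eRk_ofRankFun (hE : E.Finite) (h_empty : f ∅ = 0)
    (h_mono : ∀ X Y, X ⊆ Y → Y ⊆ E → f X ≤ f Y)
    (h_insert : ∀ X ⊆ E, ∀ e ∈ E, f (insert e X) ≤ f X + 1)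
    (h_submod : ∀ X ⊆ E, ∀ Y ⊆ E, f (X ∩ Y) + f (X ∪ Y) ≤ f X + f Y)
    {X : Set α} (hX : X ⊆ E) :
    (ofRankFun hE f h_empty h_mono h_insert h_submod).eRk X = f X := by
  set M := ofRankFun hE f h_empty h_mono h_insert h_submod with hM
  have h_ind : ∀ I, M.Indep I ↔ I ⊆ E ∧ f I = I.ncard := fun I => Iff.rfl
  obtain ⟨I, hI⟩ := M.exists_isBasis' X
  obtain ⟨hIE, hIc⟩ := (h_ind I).1 hI.indep
  have h1 : f (I ∪ X) = f I := by
    refine rankFun_union_eq hE h_mono h_submod hIE hX fun e he => ?_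
    by_cases heI : e ∈ I
    · rw [Set.insert_eq_of_mem heI]
    have h2 : ¬ M.Indep (insert e I) := fun h =>
      heI (hI.mem_of_insert_indep he h)
    rw [h_ind, Set.ncard_insert_of_notMem heI (hE.subset hIE)] at h2
    have h3 := h_insert I hIE e (hX he)
    have h4 := h_mono I (insert e I) (Set.subset_insert _ _)
      (Set.insert_subset (hX he) hIE)
    have h5 : f (insert e I) ≠ I.ncard + 1 := fun h =>
      h2 ⟨Set.insert_subset (hX he) hIE, h⟩
    omega
  rw [Set.union_eq_self_of_subset_left hI.subset] at h1
  rw [← hI.encard_eq_eRk, h1, hIc, (hE.subset hIE).cast_ncard_eq]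

end RankFunction

lemma conn_empty (M : Matroid α) : M.conn ∅ = 0 := by
  simp [conn, natRk]

section Conn

variable (M : Matroid α) [M.Finite]

lemma cast_natRk (X : Set α) : (M.natRk X : ℕ∞) = M.eRk X :=
  ENat.natCast_toNat (M.eRk_ne_top_iff.2 (RankFinite.isRkFinite X))

lemma natRk_ground_le (X : Set α) : M.natRk M.E ≤ M.natRk X + M.natRk (M.E \ X) := by
  have := M.eRk_le_eRk_inter_add_eRk_sdiff M.E X
  rw [eRk_ground_inter, ← cast_natRk, ← cast_natRk, ← cast_natRk] at this
  exact_mod_cast this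

lemma natRk_submod (X Y : Set α) :
    M.natRk (X ∩ Y) + M.natRk (X ∪ Y) ≤ M.natRk X + M.natRk Y := by
  have := M.eRk_inter_add_eRk_union_le X Y
  simp only [← cast_natRk] at this
  exact_mod_cast this

lemma conn_submod (X Y : Set α) :
    M.conn (X ∩ Y) + M.conn (X ∪ Y) ≤ M.conn X + M.conn Y := by
  have h1 := M.natRk_submod X Y
  have h2 := M.natRk_submod (M.E \ X) (M.E \ Y)
  rw [← Set.sdiff_inter, Set.sdiff_inter_sdiff] at h2
  have h3 := M.natRk_ground_le X
  have h4 := M.natRk_ground_le Y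
  have h5 := M.natRk_ground_le (X ∩ Y)
  have h6 := M.natRk_ground_le (X ∪ Y)
  unfold conn
  omega

lemma conn_singleton_le (e : α) : M.conn {e} ≤ 1 := by
  have h1 : M.natRk {e} ≤ 1 := by
    have := M.eRk_singleton_le e
    rw [← cast_natRk] at this
    exact_mod_cast this
  have h2 : M.natRk (M.E \ {e}) ≤ M.natRk M.E := by
    have := M.eRk_mono (Set.sdiff_subset (s := M.E) (t := {e}))
    rw [← cast_natRk, ← cast_natRk] at this
    exact_mod_cast this
  unfold conn
  omega

end Conn

section TangleMatroid

variable {M : Matroid α} {T : Set (Set α)} {θ : ℕ}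

lemma tangleRk_le_conn {X Y : Set α} (hY : Y ∈ T) (hXY : X ⊆ Y) :
    M.tangleRk T θ X ≤ M.conn Y := by
  rw [tangleRk, if_pos ⟨Y, hY, hXY⟩]
  exact Nat.sInf_le ⟨Y, hY, hXY, rfl⟩

lemma tangleRk_eq_or (X : Set α) : M.tangleRk T θ X = θ ∨
    ∃ Y ∈ T, X ⊆ Y ∧ M.conn Y = M.tangleRk T θ X := by
  by_cases h : ∃ Y ∈ T, X ⊆ Y
  · right
    rw [tangleRk, if_pos h]
    obtain ⟨Y, hY, hXY⟩ := h
    exact Nat.sInf_mem (s := {n | ∃ Y ∈ T, X ⊆ Y ∧ M.conn Y = n}) ⟨_, Y, hY, hXY, rfl⟩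
  · left
    rw [tangleRk, if_neg h]

lemma IsTangle.tangleRk_le (hT : M.IsTangle T θ) (X : Set α) : M.tangleRk T θ X ≤ θ := by
  obtain h | ⟨Y, hY, -, h⟩ := tangleRk_eq_or (M := M) (T := T) (θ := θ) X
  · exact h.le
  · exact h ▸ (hT.conn_lt Y hY).le

lemma IsTangle.tangleRk_mono (hT : M.IsTangle T θ) {X X' : Set α} (h : X ⊆ X') :
    M.tangleRk T θ X ≤ M.tangleRk T θ X' := by
  obtain h' | ⟨Y, hY, hXY, h'⟩ := tangleRk_eq_or (M := M) (T := T) (θ := θ) X'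
  · exact (hT.tangleRk_le X).trans h'.ge
  · exact h' ▸ tangleRk_le_conn hY (h.trans hXY)

lemma IsTangle.tangleRk_le_conn_of_subset_union (hT : M.IsTangle T θ) {X Y Y₁ Y₂ : Set α}
    (hXY : X ⊆ Y) (h₁ : Y₁ ∈ T) (h₂ : Y₂ ∈ T) (hY : Y ⊆ Y₁ ∪ Y₂) :
    M.tangleRk T θ X ≤ M.conn Y := by
  have hYE : Y ⊆ M.E :=
    hY.trans (Set.union_subset (hT.subset_ground _ h₁) (hT.subset_ground _ h₂))
  obtain hlt | hle := lt_or_ge (M.conn Y) θ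
  · obtain h | h := hT.mem_or_compl_mem Y hYE hlt
    · exact tangleRk_le_conn h hXY
    · refine absurd ?_ (hT.union_ne _ h₁ _ h₂ _ h)
      refine subset_antisymm (Set.union_subset (Set.union_subset (hT.subset_ground _ h₁)
        (hT.subset_ground _ h₂)) Set.sdiff_subset) fun x hx => ?_
      by_cases hxY : x ∈ Y
      · exact Or.inl (hY hxY)
      · exact Or.inr ⟨hx, hxY⟩
  · exact (hT.tangleRk_le X).trans hle

lemma IsTangle.tangleRk_empty (hT : M.IsTangle T θ) : M.tangleRk T θ ∅ = 0 := by
  obtain rfl | hpos := Nat.eq_zero_or_pos θ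
  · exact Nat.le_zero.1 (hT.tangleRk_le ∅)
  have h0 := M.conn_empty
  obtain h | h := hT.mem_or_compl_mem ∅ (Set.empty_subset _) (by omega)
  · exact Nat.le_zero.1 (h0 ▸ tangleRk_le_conn h subset_rfl)
  · exact absurd (by simp) (hT.union_ne _ h _ h _ h)

variable [M.Finite]

lemma IsTangle.tangleRk_insert_le (hT : M.IsTangle T θ) (X : Set α) {e : α} (he : e ∈ M.E) :
    M.tangleRk T θ (insert e X) ≤ M.tangleRk T θ X + 1 := by
  obtain hle | hlt := le_or_gt θ (M.tangleRk T θ X + 1)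
  · exact (hT.tangleRk_le _).trans hle
  obtain h | ⟨Y, hY, hXY, h⟩ := tangleRk_eq_or (M := M) (T := T) (θ := θ) X
  · omega
  have h1 := M.conn_singleton_le e
  have he' : {e} ∈ T := (hT.mem_or_compl_mem {e} (by simpa) (by omega)).resolve_right
    (hT.compl_singleton_notMem e he)
  have h2 := M.conn_submod Y {e}
  have h3 := hT.tangleRk_le_conn_of_subset_union (X := insert e X) (Y := Y ∪ {e})
    (by rw [Set.union_singleton]; exact Set.insert_subset_insert hXY) hY he' subset_rfl
  omega

lemma IsTangle.tangleRk_submod (hT : M.IsTangle T θ) (A B : Set α) :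
    M.tangleRk T θ (A ∩ B) + M.tangleRk T θ (A ∪ B) ≤
      M.tangleRk T θ A + M.tangleRk T θ B := by
  have hA := hT.tangleRk_mono (Set.inter_subset_left (s := A) (t := B))
  have hB := hT.tangleRk_mono (Set.inter_subset_right (s := A) (t := B))
  have hU := hT.tangleRk_le (A ∪ B)
  obtain h | ⟨Y, hY, hAY, h⟩ := tangleRk_eq_or (M := M) (T := T) (θ := θ) A
  · omega
  obtain h' | ⟨Z, hZ, hBZ, h'⟩ := tangleRk_eq_or (M := M) (T := T) (θ := θ) B
  · omega
  have h1 := hT.tangleRk_le_conn_of_subset_union (Set.inter_subset_inter hAY hBZ) hY hZ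
    (Set.inter_subset_left.trans Set.subset_union_left)
  have h2 := hT.tangleRk_le_conn_of_subset_union (Set.union_subset_union hAY hBZ) hY hZ
    subset_rfl
  have h3 := M.conn_submod Y Z
  omega

/-- The tangle matroid `M(T)` of a tangle `T` of `M`: the matroid on `E(M)` with rank
function `tangleRk`, see `IsTangle.eRk_matroid`. -/
def IsTangle.matroid (hT : M.IsTangle T θ) : Matroid α :=
  ofRankFun M.ground_finite (M.tangleRk T θ) hT.tangleRk_empty
    (fun _ _ h _ => hT.tangleRk_mono h)
    (fun X _ _ he => hT.tangleRk_insert_le X he)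
    (fun X _ Y _ => hT.tangleRk_submod X Y)

lemma IsTangle.matroid_ground (hT : M.IsTangle T θ) : hT.matroid.E = M.E := rfl

lemma IsTangle.eRk_matroid (hT : M.IsTangle T θ) {X : Set α} (hX : X ⊆ M.E) :
    hT.matroid.eRk X = M.tangleRk T θ X :=
  eRk_ofRankFun _ _ _ _ _ hX

end TangleMatroid

end

end Matroid

namespace Matroid

/-! ### Rank, coindependence and small separations of 3-connected matroids. -/

section Connectivity

variable {α : Type*} {M : Matroid α} {A B C D K X Y : Set α} {x : α}

/-! For `r ≤ 1` the hypotheses suffice, so let `r ≥ 2`. Since `M ＼ {e i}` is 3-connected, `e i` lies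
in no triad. Hence `e i` is an end of its fan, which supplies a triangle `{e i, f i, g i}` and a
triad `{f i, g i, h i}` (`IsFan.exists_triangle_triad`).

The tangle is needed only for pairs of lines. By the rank condition, two of the lines are skew, and
hence disjoint. A cocircuit made of two elements from each would have connectivity at most 3 in `M`,
yet it spans both lines in the tangle matroid and so needs connectivity at least 4
(`IsTangle.not_isCocircuit_of_skew`). What survives is recorded in `IsFanEnds`; the rest of the
argument is tangle-free.

The key consequence is `coindep_union_range`: the deleted set stays coindependent after adding any
two elements. For connectivity, consider a separation of the deletion. If every pair `{f i, g i}`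
lies on one side, each `e i` joins that side at no cost in rank, giving a separation of `M`.
Otherwise the triad lets one element of a split pair change sides without raising the rank sum, and
induction on the number of split pairs applies (`ncard_lt_or`). For the minor, the triangles and
triads survive the earlier deletions, so the `e i` can be removed one at a time
(`IsMinor.delete_of_triangle_triad`). -/

lemma ncard_pair_le (x y : α) : ({x, y} : Set α).ncard ≤ 2 := by
  have := Set.ncard_insert_le x {y}
  rwa [Set.ncard_singleton] at this

lemma natRk_delete (h : X ⊆ M.E \ D) : (M ＼ D).natRk X = M.natRk X := by
  rw [natRk, natRk, delete_eq_restrict, restrict_eRk_eq _ h]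

lemma IsCocircuit.not_coindep (hK : M.IsCocircuit K) : ¬ M.Coindep K :=
  hK.isCircuit.not_indep

/-- Orthogonality: a circuit through `x` inside `B` would meet `K` in `x` alone. -/
lemma IsCocircuit.notMem_closure_sdiff (hK : M.IsCocircuit K) (hx : x ∈ K)
    (h : K ∩ B ⊆ {x}) : x ∉ M.closure (B \ {x}) := by
  intro hcl
  obtain ⟨C, hCs, hC, hxC⟩ := exists_isCircuit_of_mem_closure hcl (by simp)
  refine hC.inter_isCocircuit_ne_singleton (e := x) hK (subset_antisymm ?_ (by simp [hx, hxC]))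
  rintro y ⟨hyC, hyK⟩
  obtain rfl | hy := hCs hyC
  · rfl
  · exact h ⟨hyK, hy.1⟩

variable [M.Finite]

lemma natRk_mono (h : X ⊆ Y) : M.natRk X ≤ M.natRk Y := by
  have := M.eRk_mono h
  rw [← cast_natRk, ← cast_natRk] at this
  exact_mod_cast this

lemma natRk_le_ncard (hX : X ⊆ M.E) : M.natRk X ≤ X.ncard := by
  have := M.eRk_le_encard X
  rw [← cast_natRk, ← (M.ground_finite.subset hX).cast_ncard_eq] at this
  exact_mod_cast this

lemma natRk_le_of_subset_closure (h : X ⊆ M.closure Y) : M.natRk X ≤ M.natRk Y := by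
  have := M.eRk_mono h
  rw [eRk_closure_eq, ← cast_natRk, ← cast_natRk] at this
  exact_mod_cast this

lemma natRk_insert_le : M.natRk (insert x X) ≤ M.natRk X + 1 := by
  have := M.eRk_insert_le_add_one x X
  rw [← cast_natRk, ← cast_natRk] at this
  exact_mod_cast this

lemma natRk_insert_eq (hx : x ∈ M.E \ M.closure X) :
    M.natRk (insert x X) = M.natRk X + 1 := by
  have := eRk_insert_eq_add_one hx
  rw [← cast_natRk, ← cast_natRk] at this
  exact_mod_cast this

lemma indep_of_natRk_eq (hX : X ⊆ M.E) (h : M.natRk X = X.ncard) : M.Indep X := by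
  rw [indep_iff_eRk_eq_encard, ← cast_natRk, h, (M.ground_finite.subset hX).cast_ncard_eq]

lemma Indep.natRk_eq (h : M.Indep X) : M.natRk X = X.ncard := by
  have := h.eRk_eq_encard
  rw [← cast_natRk, ← (M.ground_finite.subset h.subset_ground).cast_ncard_eq] at this
  exact_mod_cast this

lemma coindep_iff_natRk (hX : X ⊆ M.E) :
    M.Coindep X ↔ M.natRk M.E ≤ M.natRk (M.E \ X) := by
  rw [coindep_iff_compl_spanning, spanning_iff_eRk_le, eRank_def, ← cast_natRk, ← cast_natRk]
  exact_mod_cast Iff.rfl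

lemma IsKConnected.ncard_lt_or {n k : ℕ} (hM : M.IsKConnected n) (hk : k < n) (hX : X ⊆ M.E)
    (h : M.natRk X + M.natRk (M.E \ X) < M.natRk M.E + k) :
    X.ncard < k ∨ (M.E \ X).ncard < k := by
  by_contra! hcon
  refine hM k hk X (M.E \ X) ⟨Set.union_sdiff_cancel hX, Set.disjoint_sdiff_right, ?_, ?_, ?_⟩
  · rw [← (M.ground_finite.subset hX).cast_ncard_eq]
    exact_mod_cast hcon.1
  · rw [← (M.ground_finite.subset Set.sdiff_subset).cast_ncard_eq]
    exact_mod_cast hcon.2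
  · have := M.natRk_ground_le X
    unfold conn
    omega

/-- Any rank deficiency would make `X` and its complement a `|X|`-separation; four elements in total
keep the complement at least as large as `X`. -/
lemma IsKConnected.indep_coindep (hM : M.IsKConnected 3) (hE : 4 ≤ M.E.ncard) (hX : X ⊆ M.E)
    (hXc : X.ncard ≤ 2) : M.Indep X ∧ M.Coindep X := by
  have h1 := natRk_le_ncard hX
  have h2 := natRk_mono (M := M) (Set.sdiff_subset (s := M.E) (t := X))
  have h3 := Set.ncard_sdiff_add_ncard_of_subset hX M.ground_finite
  have h4 : ¬ (M.natRk X + M.natRk (M.E \ X) < M.natRk M.E + X.ncard) := fun h => by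
    have := hM.ncard_lt_or (by omega) hX h
    omega
  exact ⟨indep_of_natRk_eq hX (by omega), (coindep_iff_natRk hX).2 (by omega)⟩

lemma IsKConnected.two_lt_ncard_of_isCocircuit (hM : M.IsKConnected 3) (hE : 4 ≤ M.E.ncard)
    (hK : M.IsCocircuit K) : 2 < K.ncard := by
  by_contra! h
  exact hK.not_coindep (hM.indep_coindep hE hK.subset_ground h).2

/-- If `M ＼ {x}` is 3-connected, then `x` is in no triad of `M`. -/
lemma IsKConnected.notMem_of_isTriad (hM : (M ＼ {x}).IsKConnected 3) (hE : 5 ≤ M.E.ncard)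
    (hK : M.IsTriad K) : x ∉ K := by
  intro hx
  have hKc : K.ncard = 3 := by simp [Set.ncard, hK.2]
  have hK' : M.IsCocircuit K := hK.1
  have hfin := M.ground_finite.subset hK'.subset_ground
  have h1 := Set.ncard_sdiff_singleton_of_mem hx
  have h2 := Set.ncard_sdiff_singleton_of_mem (hK'.subset_ground hx)
  have hss : {x} ⊂ K := by
    refine (Set.singleton_subset_iff.2 hx).ssubset_of_ne fun h => ?_
    rw [← h, Set.ncard_singleton] at hKc
    omega
  have h3 := hM.two_lt_ncard_of_isCocircuit (by rw [delete_ground]; omega)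
    (hK'.delete_isCocircuit hss)
  omega

end Connectivity

/-! ### Connectivity after deleting the ends of the fans. -/

section FanEnds

variable {α ι : Type*} {M : Matroid α} {e f g h : ι → α} {A B K : Set α}

/-- A family of pairwise disjoint fans `(e i, f i, g i, h i)` of length four of `M`, starting with
a triangle, such that no `e i` is in a triad and no two of the pairs `{e i, f i}` and `{e i, g i}`
from different fans form a cocircuit. -/
structure IsFanEnds (M : Matroid α) (e f g h : ι → α) : Prop where
  isTriangle : ∀ i, M.IsTriangle {e i, f i, g i}
  isTriad : ∀ i, M.IsTriad {f i, g i, h i}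
  disjoint : ∀ i j, i ≠ j →
    Disjoint ({e i, f i, g i, h i} : Set α) {e j, f j, g j, h j}
  notMem : ∀ i K, M.IsTriad K → e i ∉ K
  not_isCocircuit : ∀ i j, i ≠ j → ∀ s ∈ ({f i, g i} : Set α), ∀ t ∈ ({f j, g j} : Set α),
    ¬ M.IsCocircuit {e i, s, e j, t}

namespace IsFanEnds

lemma e_notMem (H : M.IsFanEnds e f g h) (i : ι) : e i ∉ ({f i, g i, h i} : Set α) :=
  H.notMem i _ (H.isTriad i)

lemma notMem_range (H : M.IsFanEnds e f g h) {i : ι} {x : α}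
    (hx : x ∈ ({f i, g i, h i} : Set α)) : x ∉ Set.range e := by
  rintro ⟨j, rfl⟩
  obtain rfl | hij := eq_or_ne i j
  · exact H.e_notMem i hx
  · exact Set.disjoint_left.1 (H.disjoint i j hij) (Or.inr hx) (Or.inl rfl)

lemma pair_disjoint (H : M.IsFanEnds e f g h) {i j : ι} (hij : i ≠ j) {x : α}
    (hx : x ∈ ({f i, g i} : Set α)) : x ∉ ({f j, g j} : Set α) := by
  intro hx'
  refine Set.disjoint_left.1 (H.disjoint i j hij) (?_ : x ∈ _) ?_ <;>
    simp only [Set.mem_insert_iff, Set.mem_singleton_iff] at hx hx' ⊢ <;> tauto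

lemma range_subset (H : M.IsFanEnds e f g h) : Set.range e ⊆ M.E := by
  rintro _ ⟨i, rfl⟩
  exact (H.isTriangle i).1.subset_ground (by simp)

lemma exists_mem_pair (H : M.IsFanEnds e f g h) (hK : M.IsCocircuit K) {i : ι} (hi : e i ∈ K) :
    ∃ x ∈ K, x ∈ ({f i, g i} : Set α) := by
  by_contra! hcon
  refine (H.isTriangle i).1.inter_isCocircuit_ne_singleton (e := e i) hK
    (subset_antisymm ?_ (by simp [hi]))
  rintro x ⟨rfl | hx, hxK⟩
  · rfl
  · exact absurd hx (hcon x hxK)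

lemma e_mem_closure (H : M.IsFanEnds e f g h) {i : ι} (hA : {f i, g i} ⊆ A) :
    e i ∈ M.closure A := by
  have h1 := (H.isTriangle i).1.mem_closure_sdiff_singleton_of_mem (e := e i) (by simp)
  refine M.closure_subset_closure (Set.Subset.trans ?_ hA) h1
  rintro x ⟨rfl | hx, hne⟩
  · exact absurd rfl hne
  · exact hx

/-- The indices of the pairs `{f i, g i}` that are split by `(A, B)`. -/
def splitSet (f g : ι → α) (A B : Set α) : Set ι :=
  {i | ¬ {f i, g i} ⊆ A ∧ ¬ {f i, g i} ⊆ B}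

lemma splitSet_comm : splitSet f g A B = splitSet f g B A := by
  ext i
  exact and_comm

/-- Moving `x` across reunites pair `i` and, as the pairs are disjoint, splits no other. This is the
decrease in the induction of `ncard_lt_or`. -/
lemma splitSet_insert_ssubset (H : M.IsFanEnds e f g h) {i : ι} (hi : i ∈ splitSet f g A B)
    {x y : α} (hxy : ({x, y} : Set α) = {f i, g i}) (hyA : y ∈ A) :
    splitSet f g (insert x A) (B \ {x}) ⊂ splitSet f g A B := by
  have hx : x ∈ ({f i, g i} : Set α) := hxy ▸ Set.mem_insert _ _
  refine ⟨fun j hj => ⟨fun hA => hj.1 (hA.trans (Set.subset_insert _ _)), fun hB => ?_⟩,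
    fun hsub => (hsub hi).1 ?_⟩
  · obtain rfl | hij := eq_or_ne i j
    · refine hj.1 ?_
      rw [← hxy]
      rintro z (rfl | rfl)
      · exact Or.inl rfl
      · exact Or.inr hyA
    · exact hj.2 fun z hz => ⟨hB hz, fun hzx => H.pair_disjoint hij hx (hzx ▸ hz)⟩
  · rw [← hxy]
    rintro z (rfl | rfl)
    · exact Or.inl rfl
    · exact Or.inr hyA

variable [M.Finite]

/-- Orthogonality with the triangles forces a cocircuit inside this set to use a separate element of
`B` for each `e i` it contains. As `|B| ≤ 2`, it would be too small, a triad through some `e i`, or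
one of the four-element sets excluded by `not_isCocircuit`. -/
lemma coindep_union_range (H : M.IsFanEnds e f g h) (hM : M.IsKConnected 3)
    (hE : 4 ≤ M.E.ncard) (hB : B ⊆ M.E) (hBc : B.ncard ≤ 2) :
    M.Coindep (B ∪ Set.range e) := by
  by_contra hcon
  have hdep : M✶.Dep (B ∪ Set.range e) := ⟨hcon, Set.union_subset hB H.range_subset⟩
  obtain ⟨K, hKs, hK⟩ := hdep.exists_isCircuit_subset
  replace hK : M.IsCocircuit K := hK
  have hBfin := M.ground_finite.subset hB
  have h2 := hM.two_lt_ncard_of_isCocircuit hE hK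
  have key : ∀ i, e i ∈ K → ∃ x ∈ K, x ∈ B ∧ x ∈ ({f i, g i} : Set α) := by
    intro i hi
    obtain ⟨x, hxK, hx⟩ := H.exists_mem_pair hK hi
    refine ⟨x, hxK, (hKs hxK).resolve_right (H.notMem_range (i := i) ?_), hx⟩
    simp only [Set.mem_insert_iff, Set.mem_singleton_iff] at hx ⊢
    tauto
  by_cases hex : ∃ i, e i ∈ K
  swap
  · have : K ⊆ B := by
      intro x hx
      obtain hx' | ⟨i, rfl⟩ := hKs hx
      · exact hx'
      · exact absurd ⟨i, hx⟩ hex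
    have := Set.ncard_le_ncard this hBfin
    omega
  obtain ⟨i, hi⟩ := hex
  by_cases hex : ∃ j, j ≠ i ∧ e j ∈ K
  swap
  · have hsub : K ⊆ insert (e i) B := by
      intro x hx
      obtain hx' | ⟨j, rfl⟩ := hKs hx
      · exact Or.inr hx'
      · by_cases hji : j = i
        · exact Or.inl (by rw [hji])
        · exact absurd ⟨j, hji, hx⟩ hex
    have h3 := Set.ncard_le_ncard hsub (hBfin.insert _)
    have h4 := Set.ncard_insert_le (e i) B
    have h5 : K.ncard = 3 := by omega
    refine H.notMem i K ⟨hK, ?_⟩ hi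
    rw [← (M.ground_finite.subset hK.subset_ground).cast_ncard_eq, h5]
    rfl
  obtain ⟨j, hji, hj⟩ := hex
  obtain ⟨s, hsK, hsB, hs⟩ := key i hi
  obtain ⟨t, htK, htB, ht⟩ := key j hj
  have hst : s ≠ t := by
    rintro rfl
    exact H.pair_disjoint hji ht hs
  have hBeq : {s, t} = B := by
    refine Set.eq_of_subset_of_ncard_le ?_ ?_ hBfin
    · rintro x (rfl | rfl) <;> assumption
    · rw [Set.ncard_pair hst]
      exact hBc
  refine H.not_isCocircuit i j hji.symm s hs t ht ?_
  convert hK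
  refine subset_antisymm ?_ fun x hx => ?_
  · rintro x (rfl | rfl | rfl | rfl) <;> assumption
  · obtain hx' | ⟨l, rfl⟩ := hKs hx
    · rw [← hBeq] at hx'
      simp only [Set.mem_insert_iff, Set.mem_singleton_iff] at hx' ⊢
      tauto
    -- A third index `l` would need its own element of `B = {s, t}`, but `s` and `t` already belong
    -- to the pairs of `i` and `j`.
    · obtain ⟨y, hyK, hyB, hy⟩ := key l hx
      rw [← hBeq] at hyB
      obtain rfl | rfl := hyB
      · have : l = i := by
          by_contra hl
          exact H.pair_disjoint hl hy hs
        simp [this]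
      · have : l = j := by
          by_contra hl
          exact H.pair_disjoint hl hy ht
        simp [this]

/-- The triangle puts `e i` in the closure of `{f i, g i}`, so every `e i` can be added to the side
holding its pair without changing ranks, and 3-connectivity of `M` applies. -/
lemma ncard_lt_or_of_splitSet_eq_empty (H : M.IsFanEnds e f g h) (hM : M.IsKConnected 3) {k : ℕ}
    (hk : k ≤ 2) (hAB : A ∪ B = M.E \ Set.range e) (hdj : Disjoint A B)
    (hr : M.natRk A + M.natRk B < M.natRk M.E + k) (hS : splitSet f g A B = ∅) :
    A.ncard < k ∨ B.ncard < k := by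
  set A' := A ∪ {x | ∃ i, e i = x ∧ {f i, g i} ⊆ A} with hA'
  have hAE : A ⊆ M.E := (hAB ▸ Set.subset_union_left : A ⊆ _).trans Set.sdiff_subset
  have hBE' : B ⊆ M.E \ Set.range e := hAB ▸ Set.subset_union_right
  have hBE : B ⊆ M.E := hBE'.trans Set.sdiff_subset
  have hA'E : A' ⊆ M.E := by
    refine Set.union_subset hAE ?_
    rintro _ ⟨i, rfl, -⟩
    exact H.range_subset ⟨i, rfl⟩
  have hA'cl : A' ⊆ M.closure A := by
    refine Set.union_subset (M.subset_closure A) ?_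
    rintro _ ⟨i, rfl, hi⟩
    exact H.e_mem_closure hi
  have hB'cl : M.E \ A' ⊆ M.closure B := by
    rintro x ⟨hxE, hxA⟩
    by_cases hx : x ∈ Set.range e
    · obtain ⟨i, rfl⟩ := hx
      refine H.e_mem_closure ?_
      by_contra hB
      have : i ∈ splitSet f g A B := ⟨fun hA => hxA (Or.inr ⟨i, rfl, hA⟩), hB⟩
      simp [hS] at this
    · have : x ∈ A ∪ B := hAB ▸ ⟨hxE, hx⟩
      exact M.subset_closure B hBE (this.resolve_left fun h => hxA (Or.inl h))
  have hBB' : B ⊆ M.E \ A' := by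
    refine fun x hx => ⟨hBE hx, ?_⟩
    rintro (hxA | ⟨i, rfl, -⟩)
    · exact Set.disjoint_left.1 hdj hxA hx
    · exact (hBE' hx).2 ⟨i, rfl⟩
  have h1 := natRk_le_of_subset_closure hA'cl
  have h2 := natRk_le_of_subset_closure hB'cl
  have h3 := Set.ncard_le_ncard (hA' ▸ Set.subset_union_left : A ⊆ A') (M.ground_finite.subset hA'E)
  have h4 := Set.ncard_le_ncard hBB' (M.ground_finite.subset Set.sdiff_subset)
  have := hM.ncard_lt_or (by omega) hA'E (by omega : _ < M.natRk M.E + k)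
  omega

/-- Since the cocircuit meets `B` only in `x`, removing `x` lowers the rank of `B` by one, while
adding it raises that of `A` by at most one. The hypothesis `ih` therefore applies to the new
partition. -/
lemma ncard_lt_or_of_move (H : M.IsFanEnds e f g h) (hM : M.IsKConnected 3)
    (hE : 4 ≤ M.E.ncard) {k : ℕ} (hk : k ≤ 2) (hAB : A ∪ B = M.E \ Set.range e)
    (hdj : Disjoint A B) (hr : M.natRk A + M.natRk B < M.natRk M.E + k)
    {x y z : α} (hK : M.IsCocircuit {x, y, z}) (hx : x ∈ B) (hy : y ∈ A) (hz : z ∈ A)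
    (ih : insert x A ∪ B \ {x} = M.E \ Set.range e → Disjoint (insert x A) (B \ {x}) →
      M.natRk (insert x A) + M.natRk (B \ {x}) < M.natRk M.E + k →
      (insert x A).ncard < k ∨ (B \ {x}).ncard < k) :
    A.ncard < k ∨ B.ncard < k := by
  have hAE' : A ⊆ M.E \ Set.range e := hAB ▸ Set.subset_union_left
  have hBE' : B ⊆ M.E \ Set.range e := hAB ▸ Set.subset_union_right
  have hAE : A ⊆ M.E := hAE'.trans Set.sdiff_subset
  have hBE : B ⊆ M.E := hBE'.trans Set.sdiff_subset
  have hAfin := M.ground_finite.subset hAE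
  have hBfin := M.ground_finite.subset hBE
  have hKB : ({x, y, z} : Set α) ∩ B ⊆ {x} := by
    rintro w ⟨rfl | rfl | rfl, hw⟩
    · rfl
    · exact absurd hw (Set.disjoint_left.1 hdj hy)
    · exact absurd hw (Set.disjoint_left.1 hdj hz)
  have h1 := natRk_insert_eq ⟨hBE hx, hK.notMem_closure_sdiff (by simp) hKB⟩
  rw [Set.insert_sdiff_singleton, Set.insert_eq_of_mem hx] at h1
  have h2 := natRk_insert_le (M := M) (x := x) (X := A)
  have h3 := ih (by
      rw [← hAB]
      ext w
      by_cases hwx : w = x <;> simp [hwx, hx])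
    (by
      rw [Set.disjoint_left] at hdj ⊢
      rintro w (rfl | hw) hw'
      · exact hw'.2 rfl
      · exact hdj hw hw'.1) (by omega)
  have h4 := Set.ncard_le_ncard (Set.subset_insert x A) (hAfin.insert x)
  have h5 := Set.ncard_sdiff_singleton_add_one hx hBfin
  -- The move can only fail to transfer the bound if `|B| = k ≤ 2`. Then `B` is independent and, by
  -- coindependence of `B ∪ Set.range e`, `A` is spanning, so the rank sum is at least `r(M) + k`.
  by_contra! hcon
  have hBc : B.ncard = k := by omega
  have hco := H.coindep_union_range hM hE hBE (by omega)
  rw [coindep_iff_natRk (Set.union_subset hBE H.range_subset)] at hco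
  have hBA : M.E \ (B ∪ Set.range e) ⊆ A := by
    rintro w ⟨hwE, hw⟩
    have : w ∈ A ∪ B := hAB ▸ ⟨hwE, fun h => hw (Or.inr h)⟩
    exact this.resolve_right fun h => hw (Or.inl h)
  have h6 := natRk_mono (M := M) hBA
  have h7 := (hM.indep_coindep hE hBE (by omega)).1.natRk_eq
  omega

lemma ncard_lt_or (H : M.IsFanEnds e f g h) [Finite ι] (hM : M.IsKConnected 3)
    (hE : 4 ≤ M.E.ncard) {k : ℕ} (hk : k ≤ 2) (hAB : A ∪ B = M.E \ Set.range e)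
    (hdj : Disjoint A B) (hr : M.natRk A + M.natRk B < M.natRk M.E + k) :
    A.ncard < k ∨ B.ncard < k := by
  induction hn : (splitSet f g A B).ncard using Nat.strong_induction_on generalizing A B with
  | _ n ih =>
  -- The element that moves is the one separated from `h i` and its partner. Stating this for
  -- arbitrary `A` and `B` covers all four cases by symmetry.
  have move : ∀ {A B : Set α} {i : ι} {x y : α}, A ∪ B = M.E \ Set.range e → Disjoint A B →
      M.natRk A + M.natRk B < M.natRk M.E + k → (splitSet f g A B).ncard = n →
      i ∈ splitSet f g A B → ({x, y} : Set α) = {f i, g i} → x ∈ B → y ∈ A → h i ∈ A →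
      A.ncard < k ∨ B.ncard < k := by
    intro A B i x y hAB hdj hr hn hi hxy hx hy hz
    refine H.ncard_lt_or_of_move hM hE hk hAB hdj hr (x := x) (y := y) (z := h i) ?_ hx hy hz
      fun h1 h2 h3 => ih _ ?_ h1 h2 h3 rfl
    · have : ({x, y, h i} : Set α) = {f i, g i, h i} := by
        ext w
        have := Set.ext_iff.1 hxy w
        simp only [Set.mem_insert_iff, Set.mem_singleton_iff] at this ⊢
        tauto
      rw [this]
      exact (H.isTriad i).1
    · rw [← hn]
      exact Set.ncard_lt_ncard (H.splitSet_insert_ssubset hi hxy hy) (Set.toFinite _)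
  obtain hS | ⟨i, hi⟩ := (splitSet f g A B).eq_empty_or_nonempty
  · exact H.ncard_lt_or_of_splitSet_eq_empty hM hk hAB hdj hr hS
  have hmem : ∀ x ∈ ({f i, g i, h i} : Set α), x ∈ A ∨ x ∈ B := fun x hx => by
    have : x ∈ A ∪ B := hAB ▸ ⟨(H.isTriad i).1.subset_ground hx, H.notMem_range hx⟩
    exact this
  have hAB' : B ∪ A = M.E \ Set.range e := by rw [Set.union_comm, hAB]
  have hr' : M.natRk B + M.natRk A < M.natRk M.E + k := by omega
  have hn' : (splitSet f g B A).ncard = n := by rw [splitSet_comm, hn]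
  have hi' : i ∈ splitSet f g B A := by rwa [splitSet_comm]
  have hfA := hi.1
  have hfB := hi.2
  simp only [Set.insert_subset_iff, Set.singleton_subset_iff] at hfA hfB
  obtain hf | hf := hmem (f i) (by simp) <;> obtain hg | hg := hmem (g i) (by simp)
  · exact absurd ⟨hf, hg⟩ hfA
  · obtain hh | hh := hmem (h i) (by simp)
    · exact move hAB hdj hr hn hi (Set.pair_comm _ _) hg hf hh
    · exact (move hAB' hdj.symm hr' hn' hi' rfl hf hg hh).symm
  · obtain hh | hh := hmem (h i) (by simp)
    · exact move hAB hdj hr hn hi rfl hf hg hh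
    · exact (move hAB' hdj.symm hr' hn' hi' (Set.pair_comm _ _) hg hf hh).symm
  · exact absurd ⟨hf, hg⟩ hfB

lemma isKConnected_delete (H : M.IsFanEnds e f g h) [Finite ι] (hM : M.IsKConnected 3)
    (hE : 4 ≤ M.E.ncard) : (M ＼ Set.range e).IsKConnected 3 := by
  rintro k hk A B ⟨hAB, hdj, hA, hB, hconn⟩
  rw [delete_ground] at hAB
  have hAE : A ⊆ M.E \ Set.range e := hAB ▸ Set.subset_union_left
  have hBE : B ⊆ M.E \ Set.range e := hAB ▸ Set.subset_union_right
  have hB' : (M.E \ Set.range e) \ A = B := by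
    rw [← hAB, Set.union_sdiff_left, hdj.symm.sdiff_eq_left]
  rw [conn, delete_ground, hB', natRk_delete hAE, natRk_delete hBE,
    natRk_delete subset_rfl] at hconn
  rw [← (M.ground_finite.subset (hAE.trans Set.sdiff_subset)).cast_ncard_eq] at hA
  rw [← (M.ground_finite.subset (hBE.trans Set.sdiff_subset)).cast_ncard_eq] at hB
  have hA' : k ≤ A.ncard := by exact_mod_cast hA
  have hB' : k ≤ B.ncard := by exact_mod_cast hB
  have h1 := natRk_mono (M := M) (Set.sdiff_subset (s := M.E) (t := Set.range e))
  have := H.ncard_lt_or hM hE (k := k) (by omega) hAB hdj (by omega)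
  omega

end IsFanEnds

end FanEnds

/-! ### Keeping the minor `N`. -/

section Minor

variable {α : Type*} {M N : Matroid α} {C D K : Set α} {x y : α}

lemma IsMinor.delete_or_contract (h : N ≤m M) (hx : x ∉ N.E) :
    N ≤m M ＼ {x} ∨ N ≤m M ／ {x} := by
  by_cases hxE : x ∈ M.E
  swap
  · left
    rwa [deleteElem_eq_self hxE]
  obtain ⟨C, D, -, -, hCD, rfl⟩ := h.exists_eq_contract_delete_disjoint
  by_cases hxC : x ∈ C
  · right
    refine ⟨C \ {x}, D, ?_⟩
    rw [contract_contract, Set.union_sdiff_cancel (by simpa)]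
  · left
    have hxD : x ∈ D := by
      by_contra hxD
      exact hx ⟨⟨hxE, hxC⟩, hxD⟩
    refine ⟨C, D \ {x}, ?_⟩
    rw [← contract_delete_comm _ (by simpa), delete_delete,
      Set.union_sdiff_cancel (by simpa)]

lemma delete_isMinor' (M : Matroid α) (D : Set α) : M ＼ D ≤m M := ⟨∅, D, by simp⟩

lemma contract_isMinor' (M : Matroid α) (C : Set α) : M ／ C ≤m M := ⟨C, ∅, by simp⟩

lemma IsCircuit.contract_sdiff_delete (hC : M.IsCircuit C) (hx : x ∈ C) :
    M ／ (C \ {x}) ＼ {x} = M ／ C := by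
  have hloop : {x} ⊆ (M ／ (C \ {x})).loops := by
    rw [contract_loops_eq]
    simpa using hC.mem_closure_sdiff_singleton_of_mem hx
  rw [← contract_eq_delete_of_subset_loops hloop, contract_contract,
    Set.sdiff_union_of_subset (by simpa)]

lemma IsCocircuit.delete_sdiff_contract (hK : M.IsCocircuit K) (hx : x ∈ K) :
    M ＼ (K \ {x}) ／ {x} = M ＼ K := by
  have := congrArg dual (hK.isCircuit.contract_sdiff_delete hx)
  rwa [dual_contract_delete, dual_contract, dual_dual] at this

/-- After contracting `a` and `b`, `c` is a loop, so `N` is a minor of `M ／ {a, b, c}`. There `a`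
may be deleted instead, being a loop once `b` and `c` are contracted. -/
lemma IsMinor.of_contract_pair {a b c : α} (hC : M.IsCircuit {a, b, c}) (hac : a ≠ c)
    (hbc : b ≠ c) (h : N ≤m M ／ {a} ／ {b}) (hc : c ∉ N.E) : N ≤m M ＼ {a} := by
  have key : N ≤m M ／ {a, b, c} := by
    have h1 : ({a, b, c} : Set α) \ {c} = {a, b} := by
      ext w
      simp only [Set.mem_sdiff, Set.mem_insert_iff, Set.mem_singleton_iff]
      grind
    have h2 := hC.contract_sdiff_delete (x := c) (by simp)
    rw [h1] at h2
    rw [contract_contract, Set.singleton_union] at h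
    obtain h | h := h.delete_or_contract hc
    · rwa [h2] at h
    · rw [contract_contract] at h
      convert h using 2
      ext w
      simp only [Set.mem_union, Set.mem_insert_iff, Set.mem_singleton_iff]
      tauto
  rw [← hC.contract_sdiff_delete (x := a) (by simp),
    contract_delete_comm _ Set.disjoint_sdiff_left] at key
  exact key.trans (contract_isMinor' _ _)

/-- An element of a triangle that meets a triad in its other two elements can be deleted while
keeping a minor that avoids both the triangle and the triad. -/
lemma IsMinor.delete_of_triangle_triad {e f g h : α} (hN : N ≤m M) (hC : M.IsCircuit {e, f, g})
    (hK : M.IsCocircuit {f, g, h}) (hef : e ≠ f) (heg : e ≠ g) (heh : e ≠ h) (hfg : f ≠ g)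
    (hfh : f ≠ h) (hgh : g ≠ h) (he : e ∉ N.E) (hf : f ∉ N.E) (hg : g ∉ N.E) (hh : h ∉ N.E) :
    N ≤m M ＼ {e} := by
  have hC' : M.IsCircuit {e, g, f} := by rwa [Set.pair_comm g f]
  obtain hN | hN := hN.delete_or_contract he
  · exact hN
  obtain hN | hN := hN.delete_or_contract hf
  swap
  · exact hN.of_contract_pair hC heg hfg hg
  refine IsMinor.of_contract_pair hC' hef hfg.symm ?_ hf
  have hK' : (M ／ {e}).IsCocircuit {f, g, h} := by
    rw [contract_isCocircuit_iff]
    exact ⟨hK, by simp [hef, heg, heh]⟩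
  -- If `g` is deleted along with `f`, then `h` becomes a coloop, and deleting or contracting it is
  -- the same. In the first alternative, `g` may likewise be contracted rather than deleted.
  have hmin : N ≤m M ／ {e} ＼ {f, g, h} ∨ N ≤m M ／ {e} ／ {g} := by
    obtain hN | hN := hN.delete_or_contract hg
    · left
      have h2 := hK'.delete_sdiff_contract (x := h) (by simp)
      have h1 : ({f, g, h} : Set α) \ {h} = {f} ∪ {g} := by
        ext w
        simp only [Set.mem_sdiff, Set.mem_union, Set.mem_insert_iff, Set.mem_singleton_iff]
        grind
      rw [h1] at h2
      rw [delete_delete] at hN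
      obtain hN | hN := hN.delete_or_contract hh
      · rw [delete_delete, Set.union_assoc, Set.singleton_union, Set.singleton_union] at hN
        exact hN
      · rwa [h2] at hN
    · right
      rw [← contract_delete_comm _ (by simpa using hfg.symm)] at hN
      exact hN.trans (delete_isMinor' _ _)
  obtain hN | hN := hmin
  · rw [← hK'.delete_sdiff_contract (x := g) (by simp),
      ← contract_delete_comm _ Set.disjoint_sdiff_right] at hN
    exact hN.trans (delete_isMinor' _ _)
  · exact hN

/-- `K` stays codependent in `M ＼ D`; the condition on `L ∪ D` prevents any smaller cocircuit from
appearing inside it. -/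
lemma IsCocircuit.delete_of_forall_coindep (hK : M.IsCocircuit K) (hKD : Disjoint K D)
    (hD : ∀ L ⊂ K, M.Coindep (L ∪ D)) : (M ＼ D).IsCocircuit K := by
  rw [isCocircuit_def, dual_delete]
  have hdep := hK.isCircuit.contract_dep hKD.symm
  obtain ⟨L, hLK, hL⟩ := hdep.exists_isCircuit_subset
  obtain rfl | hss := hLK.eq_or_ssubset
  · exact hL
  have hind : M✶.Indep (L ∪ D) := hD L hss
  refine absurd ?_ hL.not_indep
  rw [(hind.subset Set.subset_union_right).contract_indep_iff]
  exact ⟨hKD.mono_left hLK, hind⟩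

/-- Deleting the ends `e i` of the fans keeps a minor that avoids the fans. -/
lemma IsFanEnds.isMinor_delete {ι : Type*} [Finite ι] [M.Finite] {e f g h : ι → α}
    (H : M.IsFanEnds e f g h) (hM : M.IsKConnected 3) (hE : 4 ≤ M.E.ncard) (hN : N ≤m M)
    (hdj : ∀ i, ∀ x ∈ ({e i, f i, g i, h i} : Set α), x ∉ N.E) : N ≤m M ＼ Set.range e := by
  suffices ∀ s : Set ι, s.Finite → N ≤m M ＼ (e '' s) by
    simpa using this Set.univ Set.finite_univ
  intro s hs
  induction s, hs using Set.Finite.induction_on with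
  | empty => simpa using hN
  | @insert i s his _ ih =>
  have hsub : e '' s ⊆ Set.range e := Set.image_subset_range _ _
  have hC := (H.isTriangle i).1
  have hK : M.IsCocircuit {f i, g i, h i} := (H.isTriad i).1
  have hKc : ({f i, g i, h i} : Set α).ncard = 3 := by simp [Set.ncard, (H.isTriad i).2]
  have hfin : ({f i, g i, h i} : Set α).Finite := Set.toFinite _
  have hdisjK : Disjoint ({f i, g i, h i} : Set α) (e '' s) :=
    Set.disjoint_left.2 fun x hx hx' => H.notMem_range hx (hsub hx')
  have hei : e i ∉ e '' s := by
    rintro ⟨j, hj, hji⟩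
    have hne : i ≠ j := by
      rintro rfl
      exact his hj
    exact Set.disjoint_left.1 (H.disjoint i j hne) (Or.inl rfl) (Or.inl hji.symm)
  have hC' : (M ＼ (e '' s)).IsCircuit {e i, f i, g i} := by
    rw [delete_isCircuit_iff]
    refine ⟨hC, Set.disjoint_left.2 ?_⟩
    rintro x (rfl | hx)
    · exact hei
    · refine fun hx' => H.notMem_range (i := i) ?_ (hsub hx')
      simp only [Set.mem_insert_iff, Set.mem_singleton_iff] at hx ⊢
      tauto
  have hK' : (M ＼ (e '' s)).IsCocircuit {f i, g i, h i} := by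
    refine hK.delete_of_forall_coindep hdisjK fun L hL => ?_
    have hLc := Set.ncard_lt_ncard hL hfin
    exact (H.coindep_union_range hM hE (hL.subset.trans hK.subset_ground) (by omega)).subset
      (Set.union_subset_union_right _ hsub)
  have hne := H.e_notMem i
  simp only [Set.mem_insert_iff, Set.mem_singleton_iff, not_or] at hne
  have hne' : f i ≠ g i ∧ f i ≠ h i ∧ g i ≠ h i := by
    refine ⟨fun h0 => ?_, fun h0 => ?_, fun h0 => ?_⟩
    · have := ncard_pair_le (g i) (h i)
      rw [h0, Set.insert_eq_of_mem (by simp)] at hKc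
      omega
    · have := ncard_pair_le (g i) (h i)
      rw [h0, Set.insert_eq_of_mem (by simp)] at hKc
      omega
    · have := ncard_pair_le (f i) (h i)
      rw [h0, Set.pair_eq_singleton] at hKc
      omega
  have key := ih.delete_of_triangle_triad hC' hK' hne.1 hne.2.1 hne.2.2 hne'.1 hne'.2.1 hne'.2.2
    (hdj i _ (by simp)) (hdj i _ (by simp)) (hdj i _ (by simp)) (hdj i _ (by simp))
  rwa [delete_delete, Set.union_singleton, ← Set.image_insert_eq] at key

end Minor

/-! ### Skew lines of the tangle matroid. -/

section Tangle

variable {α : Type*} {M : Matroid α} {T : Set (Set α)} {θ : ℕ} {A B X Y Z : Set α} {x y : α}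

lemma exists_mem_tangle_of_tangleRk_lt (h : M.tangleRk T θ X < θ) : ∃ Y ∈ T, X ⊆ Y := by
  obtain h' | ⟨Y, hY, hXY, -⟩ := tangleRk_eq_or (M := M) (T := T) (θ := θ) X
  · omega
  · exact ⟨Y, hY, hXY⟩

variable [M.Finite]

/-- A tangle member containing both elements with connectivity below two would, by 3-connectivity,
miss at most one element of `M`, which the tangle axioms forbid. -/
lemma IsTangle.two_le_tangleRk_pair (hT : M.IsTangle T θ) (hM : M.IsKConnected 3) (hθ : 2 ≤ θ)
    (hxy : x ≠ y) : 2 ≤ M.tangleRk T θ {x, y} := by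
  obtain h | ⟨Y, hY, hXY, h⟩ := tangleRk_eq_or (M := M) (T := T) (θ := θ) {x, y}
  · omega
  by_contra! hlt
  have hYE := hT.subset_ground Y hY
  have hrk := M.natRk_ground_le Y
  unfold conn at h
  obtain h1 | h1 := hM.ncard_lt_or (k := 2) (by omega) hYE (by omega)
  · have := Set.ncard_le_ncard hXY (M.ground_finite.subset hYE)
    rw [Set.ncard_pair hxy] at this
    omega
  · obtain h0 | h0 : (M.E \ Y).ncard = 0 ∨ (M.E \ Y).ncard = 1 := by omega
    · rw [Set.ncard_eq_zero (M.ground_finite.subset Set.sdiff_subset),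
        Set.sdiff_eq_empty] at h0
      exact hT.union_ne Y hY Y hY Y hY (by simpa using subset_antisymm hYE h0)
    · obtain ⟨z, hz⟩ := Set.ncard_eq_one.1 h0
      have hzE : z ∈ M.E := (hz.symm ▸ Set.mem_singleton z : z ∈ M.E \ Y).1
      refine hT.compl_singleton_notMem z hzE ?_
      rwa [← hz, Set.sdiff_sdiff_cancel_left hYE]

/-- `A` spans `X` in the tangle matroid, so it can replace `X` in any union. -/
lemma IsTangle.tangleRk_union_le_of_subset (hT : M.IsTangle T θ) (hAX : A ⊆ X)
    (h : M.tangleRk T θ X ≤ M.tangleRk T θ A) (Z : Set α) :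
    M.tangleRk T θ (X ∪ Z) ≤ M.tangleRk T θ (A ∪ Z) := by
  have h1 := hT.tangleRk_submod X (A ∪ Z)
  rw [← Set.union_assoc, Set.union_eq_self_of_subset_right hAX] at h1
  have h2 := hT.tangleRk_mono (Set.subset_inter hAX (Set.subset_union_left (s := A) (t := Z)))
  omega

lemma IsTangle.tangleRk_biUnion_le (hT : M.IsTangle T θ) {ι : Type*} {X : ι → Set α} {n : ℕ}
    (hX : ∀ i, M.tangleRk T θ (X i) ≤ n) (s : Finset ι) :
    M.tangleRk T θ (⋃ i ∈ s, X i) ≤ n * s.card := by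
  classical
  induction s using Finset.induction_on with
  | empty => simp [hT.tangleRk_empty]
  | insert i s his ih =>
    rw [Finset.set_biUnion_insert, Finset.card_insert_of_notMem his, Nat.mul_add_one]
    have := hT.tangleRk_submod (X i) (⋃ j ∈ s, X j)
    have := hX i
    omega

/-- The remaining sets contribute at most `n` each, so `X i ∪ X j` must account for the missing `2 *
n`. -/
lemma IsTangle.two_mul_le_tangleRk_union (hT : M.IsTangle T θ) {ι : Type*} [Fintype ι]
    {X : ι → Set α} {n : ℕ} (hX : ∀ i, M.tangleRk T θ (X i) ≤ n)
    (h : n * Fintype.card ι ≤ M.tangleRk T θ (⋃ i, X i)) {i j : ι} (hij : i ≠ j) :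
    2 * n ≤ M.tangleRk T θ (X i ∪ X j) := by
  classical
  have h1 := hT.tangleRk_biUnion_le hX (Finset.univ \ {i, j})
  have h2 := hT.tangleRk_submod (X i ∪ X j) (⋃ l ∈ Finset.univ \ {i, j}, X l)
  have h3 : (⋃ l, X l) ⊆ X i ∪ X j ∪ ⋃ l ∈ Finset.univ \ {i, j}, X l := by
    refine Set.iUnion_subset fun l => ?_
    by_cases hl : l = i ∨ l = j
    · obtain rfl | rfl := hl
      · exact Set.subset_union_left.trans Set.subset_union_left
      · exact Set.subset_union_right.trans Set.subset_union_left
    · exact (Set.subset_biUnion_of_mem (u := X) (by simpa using hl)).trans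
        Set.subset_union_right
  have h4 := hT.tangleRk_mono h3
  have h5 := Finset.card_sdiff_add_card_eq_card (Finset.subset_univ ({i, j} : Finset ι))
  rw [Finset.card_pair hij, Finset.card_univ] at h5
  rw [← h5, Nat.mul_add] at h
  omega

/-- Two sets of rank two that are skew in the tangle matroid are disjoint. -/
lemma IsTangle.disjoint_of_skew (hT : M.IsTangle T θ) (hM : M.IsKConnected 3) (hθ : 2 ≤ θ)
    (hE : M.E.Nontrivial) (hX : M.tangleRk T θ X ≤ 2) (hY : M.tangleRk T θ Y ≤ 2)
    (hXY : 4 ≤ M.tangleRk T θ (X ∪ Y)) : Disjoint X Y := by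
  rw [Set.disjoint_left]
  intro x hx hy
  obtain ⟨y, hyE, hyx⟩ := hE.exists_ne x
  have h1 := hT.two_le_tangleRk_pair hM hθ hyx
  have h2 := hT.tangleRk_insert_le {x} hyE
  have h3 := hT.tangleRk_mono (Set.singleton_subset_iff.2 (Set.mem_inter hx hy))
  have h4 := hT.tangleRk_submod X Y
  omega

/-- Two pairs from different skew lines of the tangle matroid do not form a cocircuit. -/
lemma IsTangle.not_isCocircuit_of_skew (hT : M.IsTangle T θ) (hM : M.IsKConnected 3) (hθ : 4 ≤ θ)
    (hX : M.tangleRk T θ X ≤ 2) (hY : M.tangleRk T θ Y ≤ 2)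
    (hXY : 4 ≤ M.tangleRk T θ (X ∪ Y)) {a b c d : α} (ha : a ∈ X) (hb : b ∈ X) (hc : c ∈ Y)
    (hd : d ∈ Y) (hab : a ≠ b) (hcd : c ≠ d) : ¬ M.IsCocircuit {a, b, c, d} := by
  intro hK
  have hKeq : ({a, b, c, d} : Set α) = {a, b} ∪ {c, d} := by
    rw [Set.insert_union, Set.singleton_union]
  have habX : {a, b} ⊆ X := by
    rintro z (rfl | rfl) <;> assumption
  have hcdY : {c, d} ⊆ Y := by
    rintro z (rfl | rfl) <;> assumption
  have h1 := hT.tangleRk_union_le_of_subset habX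
    (hX.trans (hT.two_le_tangleRk_pair hM (by omega) hab)) Y
  have h2 := hT.tangleRk_union_le_of_subset hcdY
    (hY.trans (hT.two_le_tangleRk_pair hM (by omega) hcd)) {a, b}
  rw [Set.union_comm, Set.union_comm {c, d}, ← hKeq] at h2
  obtain ⟨X', hX', hXX'⟩ := exists_mem_tangle_of_tangleRk_lt (show M.tangleRk T θ X < θ by omega)
  obtain ⟨Y', hY', hYY'⟩ := exists_mem_tangle_of_tangleRk_lt (show M.tangleRk T θ Y < θ by omega)
  -- The four elements have tangle rank at least 4, and being covered by two tangle members they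
  -- have at least this connectivity in `M`. But a cocircuit of size at most four has connectivity
  -- at most `4 - 1`, because its complement is not spanning.
  have h3 := hT.tangleRk_le_conn_of_subset_union (subset_refl ({a, b, c, d} : Set α)) hX' hY'
    (hKeq ▸ Set.union_subset_union (habX.trans hXX') (hcdY.trans hYY'))
  have h4 := hK.not_coindep
  rw [coindep_iff_natRk hK.subset_ground] at h4
  have h5 := natRk_le_ncard hK.subset_ground
  have h6 := Set.ncard_union_le {a, b} {c, d}
  have h7 := ncard_pair_le a b
  have h8 := ncard_pair_le c d
  rw [← hKeq] at h6
  unfold conn at h3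
  omega

end Tangle

/-! ### Locating the deleted element in its fan. -/

section Fan

variable {α : Type*} {M : Matroid α} {F : List α} {e : α}

lemma IsFan.isTriangle_or_isTriad (hF : M.IsFan F) (i : ℕ) (hi : i + 2 < F.length) :
    M.IsTriangle {F[i], F[i + 1], F[i + 2]} ∨ M.IsTriad {F[i], F[i + 1], F[i + 2]} := by
  induction i with
  | zero => exact hF.start
  | succ i ih =>
    exact (ih (by omega)).symm.imp (hF.triangle_of_triad i (by omega))
      (hF.triad_of_triangle i (by omega))

/-- An element of a fan of length at least four that is in no triad is an end of the fan and
of a triangle of the fan. -/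
lemma IsFan.exists_triangle_triad (hF : M.IsFan F) (hlen : 4 ≤ F.length) (he : e ∈ F)
    (hnot : ∀ K, M.IsTriad K → e ∉ K) :
    ∃ f ∈ F, ∃ g ∈ F, ∃ h ∈ F, M.IsTriangle {e, f, g} ∧ M.IsTriad {f, g, h} := by
  obtain ⟨j, hj, rfl⟩ := List.getElem_of_mem he
  have htri : ∀ i (hi : i + 2 < F.length), i ≤ j → j ≤ i + 2 →
      M.IsTriangle {F[i], F[i + 1], F[i + 2]} := by
    intro i hi h1 h2
    refine (hF.isTriangle_or_isTriad i hi).resolve_right fun h => hnot _ h ?_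
    obtain rfl | rfl | rfl : j = i ∨ j = i + 1 ∨ j = i + 2 := by omega
    all_goals simp
  -- Of two consecutive triples containing `e`, one would be a triad. So `e` lies in only one
  -- triple, which makes it an end of the fan.
  have hstep : ∀ i, i + 3 < F.length → i ≤ j → j ≤ i + 2 → i + 1 ≤ j → j ≤ i + 3 → False := by
    intro i hi h1 h2 h3 h4
    refine hnot _ (hF.triad_of_triangle i hi (htri i (by omega) h1 h2)) ?_
    obtain rfl | rfl : j = i + 1 ∨ j = i + 2 := by omega
    all_goals simp
  obtain rfl | rfl : j = 0 ∨ j = F.length - 1 := by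
    by_contra! hcon
    by_cases h2 : j = 1
    · exact hstep 0 (by omega) (by omega) (by omega) (by omega) (by omega)
    · exact hstep (j - 2) (by omega) (by omega) (by omega) (by omega) (by omega)
  · have h1 := htri 0 (by omega) (by omega) (by omega)
    exact ⟨F[1], List.getElem_mem _, F[2], List.getElem_mem _, F[3], List.getElem_mem _, h1,
      hF.triad_of_triangle 0 (by omega) h1⟩
  · obtain ⟨n, hn⟩ : ∃ n, F.length = n + 4 := ⟨F.length - 4, by omega⟩
    have h1 := htri (n + 1) (by omega) (by omega) (by omega)
    have h2 : M.IsTriad {F[n], F[n + 1], F[n + 2]} := by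
      refine (hF.isTriangle_or_isTriad n (by omega)).resolve_left fun h => ?_
      refine hnot _ (hF.triad_of_triangle n (by omega) h) ?_
      simp [hn]
    refine ⟨F[n + 2], List.getElem_mem _, F[n + 1], List.getElem_mem _, F[n],
      List.getElem_mem _, ?_, ?_⟩
    · convert h1 using 1
      simp only [hn]
      ext w
      simp only [Set.mem_insert_iff, Set.mem_singleton_iff]
      tauto
    · convert h2 using 1
      ext w
      simp only [Set.mem_insert_iff, Set.mem_singleton_iff]
      tauto

end Fan

end Matroid

/-! ### From skew lines and fans to `IsFanEnds`. -/

theorem mainTheorem8 {α : Type*} (M N : Matroid α) [M.Finite] (hM : M.IsKConnected 3)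
    (T : Set (Set α)) (θ : ℕ) (hT : M.IsTangle T θ) (hN : N ≤m M)
    (r : ℕ) (X : Fin r → Set α)
    (hX : ∀ i, hT.matroid.IsLongLine (X i))
    (h_rank : hT.matroid.eRk (⋃ i, X i) = ((2 * r : ℕ) : ℕ∞))
    (h_disj : ∀ i, X i ∩ N.E = ∅)
    (F : Fin r → List α)
    (hF : ∀ i, M.IsMaximalFan (F i))
    (hFX : ∀ i, ∀ x ∈ F i, x ∈ X i)
    (hF_len : ∀ i, 4 ≤ (F i).length)
    (e : Fin r → α) (he : ∀ i, e i ∈ F i)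
    (he_conn : ∀ i, (M ＼ {e i}).IsKConnected 3)
    (he_minor : ∀ i, N ≤m M ＼ {e i}) :
    (M ＼ Set.range e).IsKConnected 3 ∧ N ≤m M ＼ Set.range e := by
  -- Two lines are needed to force `4 ≤ θ` and five elements in `M`.
  obtain hr | hr := Nat.lt_or_ge r 2
  · interval_cases r
    · simpa using ⟨hM, hN⟩
    · have hrange : Set.range e = {e 0} := by
        rw [Set.range_unique]
        rfl
      rw [hrange]
      exact ⟨he_conn 0, he_minor 0⟩
  have hXE : ∀ i, X i ⊆ M.E := fun i => (hX i).isFlat.subset_ground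
  have hXrk : ∀ i, M.tangleRk T θ (X i) ≤ 2 := fun i => by
    have := (hX i).rank_eq
    rw [hT.eRk_matroid (hXE i)] at this
    exact_mod_cast this.le
  rw [hT.eRk_matroid (Set.iUnion_subset hXE)] at h_rank
  have h_rank' : M.tangleRk T θ (⋃ i, X i) = 2 * r := by exact_mod_cast h_rank
  have hθ : 4 ≤ θ := by
    have := hT.tangleRk_le (⋃ i, X i)
    omega
  have hskew : ∀ i j, i ≠ j → 4 ≤ M.tangleRk T θ (X i ∪ X j) := fun i j hij =>
    hT.two_mul_le_tangleRk_union hXrk (by rw [Fintype.card_fin, h_rank']) hij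
  have hFsub : ∀ i, {x | x ∈ F i} ⊆ M.E := fun i x hx => hXE i (hFX i x hx)
  have hFcard : ∀ i, 4 ≤ {x | x ∈ F i}.ncard := fun i => by
    classical
    have : {x | x ∈ F i} = ((F i).toFinset : Set α) := by
      ext x
      simp
    rw [this, Set.ncard_coe_finset, List.toFinset_card_of_nodup (hF i).1.nodup]
    exact hF_len i
  have hE : 4 ≤ M.E.ncard :=
    (hFcard ⟨0, by omega⟩).trans (Set.ncard_le_ncard (hFsub _) M.ground_finite)
  have hEnt : M.E.Nontrivial :=
    (Set.one_lt_ncard_iff_nontrivial_and_finite.1 (by omega)).1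
  have hdisj : ∀ i j, i ≠ j → Disjoint (X i) (X j) := fun i j hij =>
    hT.disjoint_of_skew hM (by omega) hEnt (hXrk i) (hXrk j) (hskew i j hij)
  -- Five elements leave four in `M ＼ {e i}`, which rules out its two-element cocircuits and hence
  -- triads of `M` through `e i`.
  have hE5 : 5 ≤ M.E.ncard := by
    have hdj : Disjoint {x | x ∈ F ⟨0, by omega⟩} {x | x ∈ F ⟨1, by omega⟩} :=
      (hdisj ⟨0, by omega⟩ ⟨1, by omega⟩ (by simp)).mono (hFX _) (hFX _)
    have h1 := Set.ncard_union_eq hdj (M.ground_finite.subset (hFsub _))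
      (M.ground_finite.subset (hFsub _))
    have h2 := Set.ncard_le_ncard (Set.union_subset (hFsub ⟨0, by omega⟩)
      (hFsub ⟨1, by omega⟩)) M.ground_finite
    have h3 := hFcard ⟨0, by omega⟩
    have h4 := hFcard ⟨1, by omega⟩
    omega
  have hnot : ∀ i K, M.IsTriad K → e i ∉ K := fun i K hK =>
    (he_conn i).notMem_of_isTriad hE5 hK
  choose f hf g hg h hh htri htriad using fun i =>
    (hF i).1.exists_triangle_triad (hF_len i) (he i) (hnot i)
  have hsub : ∀ i, ({e i, f i, g i, h i} : Set α) ⊆ X i := by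
    rintro i x (rfl | rfl | rfl | rfl)
    exacts [hFX i _ (he i), hFX i _ (hf i), hFX i _ (hg i), hFX i _ (hh i)]
  have hmem : ∀ i, ∀ s ∈ ({f i, g i} : Set α), e i ≠ s ∧ s ∈ X i := by
    intro i s hs
    have hs' : s ∈ ({f i, g i, h i} : Set α) := by
      simp only [Set.mem_insert_iff, Set.mem_singleton_iff] at hs ⊢
      tauto
    refine ⟨?_, hsub i (Or.inr hs')⟩
    rintro rfl
    exact hnot i _ (htriad i) hs'
  have H : M.IsFanEnds e f g h :=
    { isTriangle := htri
      isTriad := htriad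
      disjoint := fun i j hij => (hdisj i j hij).mono (hsub i) (hsub j)
      notMem := hnot
      not_isCocircuit := fun i j hij s hs t ht =>
        hT.not_isCocircuit_of_skew hM hθ (hXrk i) (hXrk j) (hskew i j hij) (hFX i _ (he i))
          (hmem i s hs).2 (hFX j _ (he j)) (hmem j t ht).2 (hmem i s hs).1 (hmem j t ht).1 }
  refine ⟨H.isKConnected_delete hM hE, H.isMinor_delete hM hE hN fun i x hx hxN => ?_⟩
  have : x ∈ X i ∩ N.E := ⟨hsub i hx, hxN⟩
  simp [h_disj i] at this
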